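/- Call a bounded measurable set $\Omega\subset\mathbb{R}^d$ of positive Lebesgue measure *spectral* if there is a countable set $\Lambda\subset\mathbb{R}^d$ such that the exponentials $e^{2\pi i\langle\lambda,x\rangle}$, $\lambda\in\Lambda$, form an orthogonal basis of $L^2(\Omega)$ (an orthonormal basis when $\Omega$ has measure $1$). Let $m$ denote Lebesgue measure. **Proposition 3.3.** Let $\epsilon>0$, and let $E\subset[0,\tfrac32-\epsilon]$ be a measurable set with $m(E)=1$ that tiles $\mathbb{R}$ by translations along $\mathbb{Z}$, i.e. almost every $x\in\mathbb{R}$ lies in exactly one of the sets $E+k$, $k\in\mathbb{Z}$. Let $F\subset\mathbb{R}^n$ be a bounded measurable set with $m(F)=1$. If $E\times F\subset\mathbb{R}\times\mathbb{R}^n$ is spectral, then $F$ is spectral. -/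

import Mathlib

open MeasureTheory

/-- The character `x ↦ exp (2 π i ⟨ξ, x⟩)` of frequency `ξ`. -/
noncomputable def expChar {V : Type*} [NormedAddCommGroup V] [InnerProductSpace ℝ V]
    (ξ x : V) : ℂ :=
  Complex.exp (2 * (Real.pi : ℂ) * Complex.I * ((inner ℝ ξ x : ℝ) : ℂ))

/-- `Λ` is a spectrum of `Ω`: the exponentials with frequencies in the countable set `Λ` form an
orthogonal basis of `L²(Ω)`, that is, after division by their common norm `√|Ω|` they form an
orthonormal (Hilbert) basis. If `|Ω| = 1` the exponentials themselves are an orthonormal basis. -/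
def IsSpectrum {V : Type*} [NormedAddCommGroup V] [InnerProductSpace ℝ V] [MeasureSpace V]
    (Ω Λ : Set V) : Prop :=
  Λ.Countable ∧
    ∃ b : HilbertBasis Λ ℂ (Lp ℂ 2 ((volume : Measure V).restrict Ω)), ∀ ξ : Λ,
      (b ξ : V → ℂ) =ᵐ[(volume : Measure V).restrict Ω]
        fun x => ((Real.sqrt ((volume : Measure V).real Ω) : ℝ) : ℂ)⁻¹ * expChar (ξ : V) x

/-- A (bounded, measurable) set `Ω` of positive measure is spectral if it has a spectrum. -/
def IsSpectral {V : Type*} [NormedAddCommGroup V] [InnerProductSpace ℝ V] [MeasureSpace V]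
    (Ω : Set V) : Prop :=
  ∃ Λ : Set V, IsSpectrum Ω Λ

/-- `E` tiles `ℝ` by translations along `T`: almost every point of the line lies in exactly one of
the translates `E + t`, `t ∈ T`. -/
def TilesRealBy (E T : Set ℝ) : Prop :=
  ∀ᵐ x : ℝ, ∃! t : ℝ, t ∈ T ∧ x - t ∈ E

/-- The product set `E × F` in the Euclidean space `ℝ × ℝⁿ`; `WithLp 2` provides the Euclidean
inner product `⟨(s, u), (t, v)⟩ = s t + ⟨u, v⟩`, and the volume is Lebesgue measure. -/
def euclideanProd {n : ℕ} (E : Set ℝ) (F : Set (EuclideanSpace ℝ (Fin n))) :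
    Set (WithLp 2 (ℝ × EuclideanSpace ℝ (Fin n))) :=
  {p | p.fst ∈ E ∧ p.snd ∈ F}

/-! Write e for the exponential and λ = (λ₁, λ₂) for the points of a spectrum Λ of E × F. Fix v ∈
L²(F) and s ∈ ℝ. Parseval's identity for the functions 1_P(x) e(sx) v(y), P ⊆ E, says that the
vectors U(P), with entries v̂(λ₂) 1̂_P(λ₁ - s), satisfy ⟨U(P), U(Q)⟩ = ‖v‖² |P ∩ Q| for P, Q ⊆ E. A
common translation of P and Q multiplies corresponding entries by the same unimodular number, so
this Gram kernel is translation invariant. The tiling and the bound 3/2 - ε make every x ∈ (-1, 1) a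
difference of points of E on a set of positive measure (`volume_inter_shift_ne_zero`). An averaging
argument at density points then extends the formula to small sets whose differences are near x, and
by additivity to P = Q = [0, c), c < 1 (`IsWhiteNoiseOn.norm_sq_Ico`). Thus E can be replaced by
intervals, which is `IntervalParseval`.

For almost every a, the λ₂ with λ₁ ∈ [a, a + 1) form a spectrum of F. They are orthogonal because
two terms of the interval identity already exhaust its total as c → 1
(`IntervalParseval.expCoeff_eq_zero`). They are complete because Bessel's inequality for the slabs,
averaged over a with weight |1̂_[0,c)(a)|², is an equality (`IntervalParseval.ae_tsum_slab_eq`). -/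

/-- Bounded Borel subsets of the line. -/
def BddMeas (P : Set ℝ) : Prop := MeasurableSet P ∧ Bornology.IsBounded P

namespace BddMeas

variable {P Q : Set ℝ}

theorem mono (hP : BddMeas P) (hQ : MeasurableSet Q) (h : Q ⊆ P) : BddMeas Q :=
  ⟨hQ, hP.2.subset h⟩

theorem union (hP : BddMeas P) (hQ : BddMeas Q) : BddMeas (P ∪ Q) :=
  ⟨hP.1.union hQ.1, hP.2.union hQ.2⟩

theorem inter (hP : BddMeas P) (hQ : MeasurableSet Q) : BddMeas (P ∩ Q) :=
  hP.mono (hP.1.inter hQ) Set.inter_subset_left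

theorem diff (hP : BddMeas P) (hQ : MeasurableSet Q) : BddMeas (P \ Q) :=
  hP.mono (hP.1.diff hQ) Set.sdiff_subset

theorem shift (hP : BddMeas P) (s : ℝ) : BddMeas ((fun u => u + s) ⁻¹' P) := by
  refine ⟨measurable_id.add_const s hP.1, ?_⟩
  obtain ⟨r, hr⟩ := hP.2.subset_closedBall s
  refine (Metric.isBounded_closedBall (x := (0 : ℝ)) (r := r)).subset fun u hu => ?_
  have := hr hu
  simpa [Real.dist_eq] using this

theorem volume_ne_top (hP : BddMeas P) : volume P ≠ ⊤ := hP.2.measure_lt_top.ne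

end BddMeas

theorem bddMeas_Ico (a b : ℝ) : BddMeas (Set.Ico a b) :=
  ⟨measurableSet_Ico, Metric.isBounded_Ico a b⟩

theorem volume_real_shift (s : ℝ) (P : Set ℝ) :
    volume.real ((fun u => u + s) ⁻¹' P) = volume.real P := by
  simp [Measure.real, measure_preimage_add_right]

/-! ### White noise and its Gram defect -/

/-- A finitely additive vector measure on bounded Borel sets with translation invariant Gram
kernel, which on subsets of `E` is `C` times Lebesgue measure of the intersection. -/
structure IsWhiteNoiseOn {H : Type*} [NormedAddCommGroup H] [InnerProductSpace ℂ H]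
    (U : Set ℝ → H) (C : ℝ) (E : Set ℝ) : Prop where
  nonneg : 0 ≤ C
  add : ∀ P Q, BddMeas P → BddMeas Q → Disjoint P Q → U (P ∪ Q) = U P + U Q
  shift : ∀ s P Q, BddMeas P → BddMeas Q →
    inner ℂ (U ((fun u => u + s) ⁻¹' P)) (U ((fun u => u + s) ⁻¹' Q)) = inner ℂ (U P) (U Q)
  gram : ∀ P Q, BddMeas P → BddMeas Q → P ⊆ E → Q ⊆ E →
    inner ℂ (U P) (U Q) = ((C * volume.real (P ∩ Q) : ℝ) : ℂ)

/-- The difference between the Gram kernel of `U` and that of white noise. -/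
noncomputable def gramDefect {H : Type*} [NormedAddCommGroup H] [InnerProductSpace ℂ H]
    (U : Set ℝ → H) (C : ℝ) (P Q : Set ℝ) : ℂ :=
  inner ℂ (U P) (U Q) - ((C * volume.real (P ∩ Q) : ℝ) : ℂ)

/-- All differences `y - z` with `y ∈ P`, `z ∈ Q` are within `r` of `x`. -/
def DiffNear (x r : ℝ) (P Q : Set ℝ) : Prop := ∀ y ∈ P, ∀ z ∈ Q, |y - z - x| < r

theorem DiffNear.mono {x r : ℝ} {P Q P' Q' : Set ℝ} (h : DiffNear x r P Q) (hP : P' ⊆ P)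
    (hQ : Q' ⊆ Q) : DiffNear x r P' Q' := fun y hy z hz => h y (hP hy) z (hQ hz)

theorem DiffNear.shift {x r : ℝ} {P Q : Set ℝ} (h : DiffNear x r P Q) (s : ℝ) :
    DiffNear x r ((fun u => u + s) ⁻¹' P) ((fun u => u + s) ⁻¹' Q) := by
  intro y hy z hz
  have := h _ hy _ hz
  simpa using this

theorem lintegral_volume_shift_inter {P G : Set ℝ} (hP : MeasurableSet P) (hG : MeasurableSet G) :
    ∫⁻ s, volume ((fun u => u + s) ⁻¹' P ∩ G) = volume P * volume G := by
  have key : ∀ s, volume ((fun u => u + s) ⁻¹' P ∩ G)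
      = ∫⁻ u, P.indicator 1 (u + s) * G.indicator 1 u := by
    intro s
    have hm : MeasurableSet ((fun u => u + s) ⁻¹' P ∩ G) := (measurable_id.add_const s hP).inter hG
    rw [← lintegral_indicator_one hm]
    refine lintegral_congr fun u => ?_
    by_cases h1 : u + s ∈ P <;> by_cases h2 : u ∈ G <;> simp [Set.indicator, h1, h2]
  simp_rw [key]
  have hm : Measurable fun p : ℝ × ℝ =>
      P.indicator (1 : ℝ → ENNReal) (p.2 + p.1) * G.indicator (1 : ℝ → ENNReal) p.2 :=
    (((measurable_one.indicator hP).comp (measurable_snd.add measurable_fst))).mul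
      ((measurable_one.indicator hG).comp measurable_snd)
  rw [lintegral_lintegral_swap (f := fun s u =>
    P.indicator (1 : ℝ → ENNReal) (u + s) * G.indicator (1 : ℝ → ENNReal) u) hm.aemeasurable]
  have : ∀ u, ∫⁻ s, P.indicator (1 : ℝ → ENNReal) (u + s) * G.indicator (1 : ℝ → ENNReal) u
      = volume P * G.indicator 1 u := by
    intro u
    have hm : Measurable fun s => P.indicator (1 : ℝ → ENNReal) (u + s) :=
      (measurable_one.indicator hP).comp (measurable_const_add u)
    rw [lintegral_mul_const _ hm,
      lintegral_add_left_eq_self (fun s => P.indicator (1 : ℝ → ENNReal) s) u,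
      lintegral_indicator_one hP]
  simp_rw [this]
  rw [lintegral_const_mul _ (measurable_one.indicator hG), lintegral_indicator_one hG]

namespace IsWhiteNoiseOn

variable {H : Type*} [NormedAddCommGroup H] [InnerProductSpace ℂ H] {U : Set ℝ → H} {C : ℝ}
  {E : Set ℝ}

theorem gramDefect_union_left (hU : IsWhiteNoiseOn U C E) {P P' Q : Set ℝ} (hP : BddMeas P)
    (hP' : BddMeas P') (hd : Disjoint P P') (hQ : BddMeas Q) :
    gramDefect U C (P ∪ P') Q = gramDefect U C P Q + gramDefect U C P' Q := by
  have h1 : volume.real ((P ∪ P') ∩ Q) = volume.real (P ∩ Q) + volume.real (P' ∩ Q) := by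
    rw [Set.union_inter_distrib_right]
    exact measureReal_union (hd.mono Set.inter_subset_left Set.inter_subset_left)
      (hP'.1.inter hQ.1) (hP.inter hQ.1).volume_ne_top (hP'.inter hQ.1).volume_ne_top
  simp only [gramDefect, hU.add P P' hP hP' hd, inner_add_left, h1]
  push_cast
  ring

theorem gramDefect_union_right (hU : IsWhiteNoiseOn U C E) {P Q Q' : Set ℝ} (hP : BddMeas P)
    (hQ : BddMeas Q) (hQ' : BddMeas Q') (hd : Disjoint Q Q') :
    gramDefect U C P (Q ∪ Q') = gramDefect U C P Q + gramDefect U C P Q' := by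
  have h1 : volume.real (P ∩ (Q ∪ Q')) = volume.real (P ∩ Q) + volume.real (P ∩ Q') := by
    rw [Set.inter_union_distrib_left]
    exact measureReal_union (hd.mono Set.inter_subset_right Set.inter_subset_right)
      (hP.1.inter hQ'.1) (hP.inter hQ.1).volume_ne_top (hP.inter hQ'.1).volume_ne_top
  simp only [gramDefect, hU.add Q Q' hQ hQ' hd, inner_add_right, h1]
  push_cast
  ring

theorem gramDefect_shift (hU : IsWhiteNoiseOn U C E) {P Q : Set ℝ} (hP : BddMeas P)
    (hQ : BddMeas Q) (s : ℝ) :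
    gramDefect U C ((fun u => u + s) ⁻¹' P) ((fun u => u + s) ⁻¹' Q) = gramDefect U C P Q := by
  simp only [gramDefect, hU.shift s P Q hP hQ, ← Set.preimage_inter, volume_real_shift]

theorem gramDefect_eq_zero (hU : IsWhiteNoiseOn U C E) {P Q : Set ℝ} (hP : BddMeas P)
    (hQ : BddMeas Q) (hPE : P ⊆ E) (hQE : Q ⊆ E) : gramDefect U C P Q = 0 := by
  simp [gramDefect, hU.gram P Q hP hQ hPE hQE]

theorem norm_eq_of_subset_shift (hU : IsWhiteNoiseOn U C E) {P : Set ℝ} (hP : BddMeas P)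
    {s : ℝ} (h : (fun u => u + s) ⁻¹' P ⊆ E) : ‖U P‖ = √C * √(volume.real P) := by
  have h1 := hU.gram _ _ (hP.shift s) (hP.shift s) h h
  rw [hU.shift s P P hP hP, ← Set.preimage_inter, volume_real_shift, Set.inter_self,
    inner_self_eq_norm_sq_to_K] at h1
  have h2 : ‖U P‖ ^ 2 = C * volume.real P := by
    apply Complex.ofReal_injective
    rw [← h1]
    simp
  rw [← Real.sqrt_mul hU.nonneg, ← h2, Real.sqrt_sq (norm_nonneg _)]

/-- The a priori bound, by Cauchy–Schwarz. The shifts s and t may differ, because each norm is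
translation invariant by itself. -/
theorem norm_gramDefect_le (hU : IsWhiteNoiseOn U C E) {P Q : Set ℝ} (hP : BddMeas P)
    (hQ : BddMeas Q) {s t : ℝ} (hs : (fun u => u + s) ⁻¹' P ⊆ E)
    (ht : (fun u => u + t) ⁻¹' Q ⊆ E) :
    ‖gramDefect U C P Q‖ ≤ 2 * C * (√(volume.real P) * √(volume.real Q)) := by
  have h1 : ‖(inner ℂ (U P) (U Q) : ℂ)‖ ≤ C * (√(volume.real P) * √(volume.real Q)) := by
    refine (norm_inner_le_norm _ _).trans ?_
    rw [hU.norm_eq_of_subset_shift hP hs, hU.norm_eq_of_subset_shift hQ ht]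
    have := Real.mul_self_sqrt hU.nonneg
    apply le_of_eq
    linear_combination (√(volume.real P) * √(volume.real Q)) * this
  have h2 : volume.real (P ∩ Q) ≤ √(volume.real P) * √(volume.real Q) := by
    have a : volume.real (P ∩ Q) ≤ volume.real P :=
      measureReal_mono Set.inter_subset_left hP.volume_ne_top
    have b : volume.real (P ∩ Q) ≤ volume.real Q :=
      measureReal_mono Set.inter_subset_right hQ.volume_ne_top
    calc volume.real (P ∩ Q) = √(volume.real (P ∩ Q)) * √(volume.real (P ∩ Q)) :=
          (Real.mul_self_sqrt measureReal_nonneg).symm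
      _ ≤ _ := by gcongr
  have h3 : ‖((C * volume.real (P ∩ Q) : ℝ) : ℂ)‖ ≤ C * (√(volume.real P) * √(volume.real Q)) := by
    rw [Complex.norm_real, Real.norm_of_nonneg (mul_nonneg hU.nonneg measureReal_nonneg)]
    exact mul_le_mul_of_nonneg_left h2 hU.nonneg
  calc _ ≤ _ := norm_sub_le _ _
    _ ≤ _ := add_le_add h1 h3
    _ = _ := by ring

end IsWhiteNoiseOn

/-! ### Averaging at density points -/

/-- If `E` nearly fills the balls of radius `R` around `q` and `q + x`, then a common translate of
`P` and `Q` has most of its mass in `E`. -/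
theorem exists_shift_volume_diff_le {E P Q : Set ℝ} (hE : MeasurableSet E) {x q R : ℝ} (hR : 0 < R)
    (h1 : volume (Metric.closedBall q R \ E) ≤ ENNReal.ofReal (R / 32))
    (h2 : volume (Metric.closedBall (q + x) R \ E) ≤ ENNReal.ofReal (R / 32))
    (hP : BddMeas P) (hQ : BddMeas Q) (hPQ : DiffNear x (R / 4) P Q)
    (hP0 : volume P ≠ 0) (hQ0 : volume Q ≠ 0) :
    ∃ s, volume.real ((fun u => u + s) ⁻¹' P \ E) ≤ volume.real P / 16 ∧
      volume.real ((fun u => u + s) ⁻¹' Q \ E) ≤ volume.real Q / 16 := by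
  obtain ⟨z₀, hz₀⟩ := nonempty_of_measure_ne_zero hQ0
  obtain ⟨y₀, hy₀⟩ := nonempty_of_measure_ne_zero hP0
  -- For s within R/2 of z₀ - q, the translate of Q stays in the ball around q and that of P in the
  -- ball around q + x, so what they lose outside E lies in G2 and G1.
  set B := Metric.closedBall (z₀ - q) (R / 2) with hB
  set G1 := Metric.closedBall (q + x) R \ E
  set G2 := Metric.closedBall q R \ E
  have hG1 : MeasurableSet G1 := Metric.isClosed_closedBall.measurableSet.diff hE
  have hG2 : MeasurableSet G2 := Metric.isClosed_closedBall.measurableSet.diff hE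
  have hBv : volume B = ENNReal.ofReal R := by
    rw [hB, Real.volume_closedBall]; congr 1; ring
  have meas : ∀ {S G : Set ℝ}, MeasurableSet S → MeasurableSet G →
      Measurable fun s => volume ((fun u => u + s) ⁻¹' S ∩ G) := by
    intro S G hS hG
    have : MeasurableSet {p : ℝ × ℝ | p.2 + p.1 ∈ S ∧ p.2 ∈ G} :=
      ((measurable_snd.add measurable_fst) hS).inter (measurable_snd hG)
    exact measurable_measure_prodMk_left this
  -- The weights |Q| and |P| make both terms comparable with |P| |Q|, so one good s serves both
  -- sets. By Tonelli the integral is at most (R/16) |P| |Q|, and B has length R.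
  let f : ℝ → ENNReal := fun s => volume ((fun u => u + s) ⁻¹' P ∩ G1) * volume Q +
    volume ((fun u => u + s) ⁻¹' Q ∩ G2) * volume P
  have hf : Measurable f := ((meas hP.1 hG1).mul_const _).add ((meas hQ.1 hG2).mul_const _)
  obtain ⟨s, hsB, hs⟩ := exists_le_setLAverage (μ := volume) (s := B) (f := f)
    (by rw [hBv]; simpa using hR) (by rw [hBv]; simp) hf.aemeasurable
  have hint : ∫⁻ s in B, f s ≤ ENNReal.ofReal (R / 16) * (volume P * volume Q) := by
    calc ∫⁻ s in B, f s ≤ ∫⁻ s, f s := setLIntegral_le_lintegral _ _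
      _ = volume P * volume G1 * volume Q + volume Q * volume G2 * volume P := by
          simp only [f]
          rw [lintegral_add_left ((meas hP.1 hG1).mul_const _),
            lintegral_mul_const _ (meas hP.1 hG1), lintegral_mul_const _ (meas hQ.1 hG2),
            lintegral_volume_shift_inter hP.1 hG1, lintegral_volume_shift_inter hQ.1 hG2]
      _ ≤ volume P * ENNReal.ofReal (R / 32) * volume Q +
          volume Q * ENNReal.ofReal (R / 32) * volume P := by gcongr
      _ = (ENNReal.ofReal (R / 32) + ENNReal.ofReal (R / 32)) * (volume P * volume Q) := by ring
      _ = _ := by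
          rw [← ENNReal.ofReal_add (by positivity) (by positivity)]; congr 2; ring
  have hfs : f s ≤ ENNReal.ofReal (1 / 16) * (volume P * volume Q) := by
    refine hs.trans ?_
    rw [setLAverage_eq, hBv]
    refine ENNReal.div_le_of_le_mul (hint.trans (le_of_eq ?_))
    rw [mul_right_comm, ← ENNReal.ofReal_mul (by norm_num)]
    congr 2; ring
  have hsd : |s - (z₀ - q)| ≤ R / 2 := hsB
  rw [abs_le] at hsd
  have hsubP : (fun u => u + s) ⁻¹' P \ E ⊆ (fun u => u + s) ⁻¹' P ∩ G1 := by
    rintro u ⟨hu, huE⟩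
    refine ⟨hu, ?_, huE⟩
    have := abs_lt.1 (hPQ _ hu _ hz₀)
    rw [Metric.mem_closedBall, Real.dist_eq, abs_le]
    constructor <;> linarith
  have hsubQ : (fun u => u + s) ⁻¹' Q \ E ⊆ (fun u => u + s) ⁻¹' Q ∩ G2 := by
    rintro u ⟨hu, huE⟩
    refine ⟨hu, ?_, huE⟩
    have a := abs_lt.1 (hPQ _ hy₀ _ hu)
    have b := abs_lt.1 (hPQ _ hy₀ _ hz₀)
    rw [Metric.mem_closedBall, Real.dist_eq, abs_le]
    constructor <;> linarith
  have fin : ∀ {S T W : Set ℝ}, BddMeas S → BddMeas T → volume T ≠ 0 →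
      volume W * volume T ≤ ENNReal.ofReal (1 / 16) * (volume S * volume T) →
      volume.real W ≤ volume.real S / 16 := by
    intro S T W hS hT hT0 h
    rw [← mul_assoc] at h
    have h' := (ENNReal.mul_le_mul_iff_left hT0 hT.volume_ne_top).1 h
    have := ENNReal.toReal_mono (ENNReal.mul_ne_top (by simp) hS.volume_ne_top) h'
    rw [ENNReal.toReal_mul, ENNReal.toReal_ofReal (by norm_num)] at this
    simp only [Measure.real]; linarith
  refine ⟨s, fin hP hQ hQ0 ?_, fin hQ hP hP0 ?_⟩
  · refine le_trans ?_ hfs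
    refine le_trans ?_ le_self_add
    gcongr
  · rw [mul_comm (volume Q) (volume P)]
    refine le_trans ?_ hfs
    refine le_trans ?_ le_add_self
    gcongr

theorem exists_volume_closedBall_diff_le {S : Set ℝ} (hS : MeasurableSet S) (h0 : volume S ≠ 0) :
    ∃ q, ∃ R₀ > 0, ∀ R, 0 < R → R < R₀ →
      volume (Metric.closedBall q R \ S) ≤ ENNReal.ofReal (R / 32) := by
  have hae := Besicovitch.ae_tendsto_measure_inter_div (volume : Measure ℝ) S
  have : (ae (volume.restrict S)).NeBot := by
    rw [ae_neBot]; simpa [Measure.restrict_eq_zero] using h0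
  obtain ⟨q, hq⟩ := hae.exists
  -- Density 63/64 in a ball of length 2R leaves at most 2R/64 = R/32 uncovered.
  have hlt : ENNReal.ofReal (63 / 64) < 1 := by
    rw [← ENNReal.ofReal_one]; exact (ENNReal.ofReal_lt_ofReal_iff one_pos).2 (by norm_num)
  have hev := hq.eventually (lt_mem_nhds hlt)
  obtain ⟨R₀, hR₀, hR⟩ := mem_nhdsGT_iff_exists_Ioo_subset.1 hev
  refine ⟨q, R₀, hR₀, fun R h1 h2 => ?_⟩
  have h3 : ENNReal.ofReal (63 / 64) <
      volume (S ∩ Metric.closedBall q R) / volume (Metric.closedBall q R) := hR ⟨h1, h2⟩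
  rw [Real.volume_closedBall] at h3
  have h4 : ENNReal.ofReal (63 / 64) * ENNReal.ofReal (2 * R) ≤
      volume (S ∩ Metric.closedBall q R) := ENNReal.mul_le_of_le_div h3.le
  have hfin : volume (Metric.closedBall q R ∩ S) ≠ ⊤ :=
    ((measure_mono Set.inter_subset_left).trans_lt measure_closedBall_lt_top).ne
  rw [← ENNReal.ofReal_mul (by norm_num), Set.inter_comm] at h4
  have h5 := measure_inter_add_sdiff (μ := volume) (Metric.closedBall q R) hS
  rw [Real.volume_closedBall] at h5
  have h6 : volume (Metric.closedBall q R \ S) + ENNReal.ofReal (63 / 64 * (2 * R)) ≤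
      ENNReal.ofReal (R / 32) + ENNReal.ofReal (63 / 64 * (2 * R)) := by
    rw [← ENNReal.ofReal_add (by positivity) (by positivity)]
    calc _ ≤ volume (Metric.closedBall q R \ S) + volume (Metric.closedBall q R ∩ S) := by gcongr
      _ = ENNReal.ofReal (2 * R) := by rw [add_comm, h5]
      _ = _ := by congr 1; ring
  exact (ENNReal.add_le_add_iff_right ENNReal.ofReal_ne_top).1 h6

namespace IsWhiteNoiseOn

variable {H : Type*} [NormedAddCommGroup H] [InnerProductSpace ℂ H] {U : Set ℝ → H} {C : ℝ}
  {E : Set ℝ}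

theorem map_empty (hU : IsWhiteNoiseOn U C E) : U ∅ = 0 := by
  rw [← norm_eq_zero, hU.norm_eq_of_subset_shift (s := 0)
    ⟨MeasurableSet.empty, Bornology.isBounded_empty⟩ (by simp)]
  simp

/-- One averaging step: near a density point, any bound on the defect can be halved. -/
theorem norm_gramDefect_le_half (hU : IsWhiteNoiseOn U C E) (hE : MeasurableSet E)
    {x q R M : ℝ} (hR : 0 < R) (hM0 : 0 ≤ M)
    (h1 : volume (Metric.closedBall q R \ E) ≤ ENNReal.ofReal (R / 32))
    (h2 : volume (Metric.closedBall (q + x) R \ E) ≤ ENNReal.ofReal (R / 32))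
    (hM : ∀ P Q, BddMeas P → BddMeas Q → DiffNear x (R / 4) P Q →
      ‖gramDefect U C P Q‖ ≤ M * (√(volume.real P) * √(volume.real Q)))
    {P Q : Set ℝ} (hP : BddMeas P) (hQ : BddMeas Q) (hPQ : DiffNear x (R / 4) P Q) :
    ‖gramDefect U C P Q‖ ≤ M / 2 * (√(volume.real P) * √(volume.real Q)) := by
  by_cases hP0 : volume.real P = 0
  · simpa [hP0] using hM P Q hP hQ hPQ
  by_cases hQ0 : volume.real Q = 0
  · simpa [hQ0] using hM P Q hP hQ hPQ
  obtain ⟨s, hsP, hsQ⟩ := exists_shift_volume_diff_le hE hR h1 h2 hP hQ hPQ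
    (fun h => hP0 (by simp [Measure.real, h])) (fun h => hQ0 (by simp [Measure.real, h]))
  have hsqrt : ∀ {W S : Set ℝ}, volume.real W ≤ volume.real S / 16 →
      √(volume.real W) ≤ √(volume.real S) / 4 := by
    intro W S h
    rw [show √(volume.real S) / 4 = √(volume.real S / 16) by
      rw [Real.sqrt_div measureReal_nonneg, show (16 : ℝ) = 4 ^ 2 by norm_num,
        Real.sqrt_sq (by norm_num)]]
    exact Real.sqrt_le_sqrt h
  rw [← hU.gramDefect_shift hP hQ s]
  have hd := hPQ.shift s
  set P' := (fun u => u + s) ⁻¹' P with hP'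
  set Q' := (fun u => u + s) ⁻¹' Q with hQ'
  have bP : BddMeas P' := hP.shift s
  have bQ : BddMeas Q' := hQ.shift s
  have vP : volume.real P' = volume.real P := volume_real_shift s P
  have vQ : volume.real Q' = volume.real Q := volume_real_shift s Q
  -- The part with both sets in E has no defect. Each remaining term has one factor with at most
  -- 1/16 of the mass; square roots give 1/4 + 1/4 = 1/2.
  have e : gramDefect U C P' Q' =
      gramDefect U C (P' ∩ E) (Q' \ E) + gramDefect U C (P' \ E) Q' := by
    conv_lhs => rw [← Set.inter_union_sdiff P' E]
    rw [hU.gramDefect_union_left (bP.inter hE) (bP.diff hE) Set.disjoint_sdiff_inter.symm bQ]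
    conv_lhs => rw [← Set.inter_union_sdiff Q' E]
    rw [hU.gramDefect_union_right (bP.inter hE) (bQ.inter hE) (bQ.diff hE)
      Set.disjoint_sdiff_inter.symm,
      hU.gramDefect_eq_zero (bP.inter hE) (bQ.inter hE) Set.inter_subset_right
      Set.inter_subset_right, zero_add, Set.inter_union_sdiff]
  have b1 := hM _ _ (bP.inter hE) (bQ.diff hE) (hd.mono Set.inter_subset_left Set.sdiff_subset)
  have b2 := hM _ _ (bP.diff hE) bQ (hd.mono Set.sdiff_subset subset_rfl)
  have c1 : √(volume.real (P' ∩ E)) ≤ √(volume.real P) :=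
    Real.sqrt_le_sqrt (vP ▸ measureReal_mono Set.inter_subset_left bP.volume_ne_top)
  rw [e]
  calc _ ≤ _ := norm_add_le _ _
    _ ≤ _ := add_le_add b1 b2
    _ ≤ M * (√(volume.real P) * (√(volume.real Q) / 4)) +
        M * ((√(volume.real P) / 4) * √(volume.real Q)) := by
      rw [vQ]
      gcongr
      · exact hsqrt hsQ
      · exact hsqrt hsP
    _ = _ := by ring

/-- At a density point q of E ∩ (E - x), both q and q + x are density points of E. Halving the a
priori bound 2C indefinitely forces the defect to vanish. -/
theorem exists_gramDefect_eq_zero_near (hU : IsWhiteNoiseOn U C E) (hE : MeasurableSet E)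
    {a d x : ℝ} (hd : 0 < d) (hI : Set.Ioo a (a + d) ⊆ E)
    (hx : volume {w | w ∈ E ∧ w + x ∈ E} ≠ 0) :
    ∃ r > 0, ∀ P Q, BddMeas P → BddMeas Q → DiffNear x r P Q → gramDefect U C P Q = 0 := by
  have hS : MeasurableSet {w | w ∈ E ∧ w + x ∈ E} := hE.inter (measurable_add_const x hE)
  obtain ⟨q, R₀, hR₀, hq⟩ := exists_volume_closedBall_diff_le hS hx
  -- R ≤ d lets P and Q, each of diameter at most R/2, be moved into the interval in E, as the a
  -- priori bound requires.
  set R := min (R₀ / 2) d with hRdef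
  have hR : 0 < R := lt_min (by linarith) hd
  have hRR : R < R₀ := (min_le_left _ _).trans_lt (by linarith)
  have hRd : R ≤ d := min_le_right _ _
  have hqR := hq R hR hRR
  have h1 : volume (Metric.closedBall q R \ E) ≤ ENNReal.ofReal (R / 32) :=
    (measure_mono (Set.sdiff_subset_sdiff_right fun w hw => hw.1)).trans hqR
  have h2 : volume (Metric.closedBall (q + x) R \ E) ≤ ENNReal.ofReal (R / 32) := by
    rw [← measure_preimage_add_right volume x]
    refine (measure_mono ?_).trans hqR
    rintro w ⟨hw, hwE⟩
    refine ⟨?_, fun h => hwE h.2⟩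
    simpa [Real.dist_eq] using hw
  refine ⟨R / 4, by positivity, ?_⟩
  have base : ∀ P Q, BddMeas P → BddMeas Q → DiffNear x (R / 4) P Q →
      ‖gramDefect U C P Q‖ ≤ 2 * C * (√(volume.real P) * √(volume.real Q)) := by
    intro P Q hP hQ hPQ
    rcases P.eq_empty_or_nonempty with rfl | ⟨y₀, hy₀⟩
    · simp [gramDefect, hU.map_empty]
    rcases Q.eq_empty_or_nonempty with rfl | ⟨z₀, hz₀⟩
    · simp [gramDefect, hU.map_empty]
    have h00 := abs_lt.1 (hPQ _ hy₀ _ hz₀)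
    refine hU.norm_gramDefect_le hP hQ (s := y₀ - (a + d / 2)) (t := z₀ - (a + d / 2)) ?_ ?_
    · intro u hu
      have := abs_lt.1 (hPQ _ hu _ hz₀)
      exact hI ⟨by linarith, by linarith⟩
    · intro u hu
      have := abs_lt.1 (hPQ _ hy₀ _ hu)
      exact hI ⟨by linarith, by linarith⟩
  have iter : ∀ k : ℕ, ∀ P Q, BddMeas P → BddMeas Q → DiffNear x (R / 4) P Q →
      ‖gramDefect U C P Q‖ ≤ 2 * C * (1 / 2) ^ k * (√(volume.real P) * √(volume.real Q)) := by
    intro k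
    induction k with
    | zero => simpa using base
    | succ k ih =>
      intro P Q hP hQ hPQ
      have := hU.norm_gramDefect_le_half hE hR
        (mul_nonneg (mul_nonneg two_pos.le hU.nonneg) (by positivity)) h1 h2 ih hP hQ hPQ
      refine this.trans (le_of_eq ?_)
      rw [pow_succ]; ring
  intro P Q hP hQ hPQ
  rw [← norm_le_zero_iff]
  have ht : Filter.Tendsto (fun k : ℕ => 2 * C * (1 / 2 : ℝ) ^ k *
      (√(volume.real P) * √(volume.real Q))) Filter.atTop (nhds 0) := by
    have := ((tendsto_pow_atTop_nhds_zero_of_lt_one (r := (1 / 2 : ℝ)) (by norm_num)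
      (by norm_num)).const_mul (2 * C)).mul_const (√(volume.real P) * √(volume.real Q))
    simpa using this
  exact ge_of_tendsto' ht fun k => iter k P Q hP hQ hPQ

/-- If `E` contains an interval and all differences in `(-1, 1)` are essential differences of `E`,
then white noise on `E` is white noise on every interval of length less than one. -/
theorem norm_sq_Ico (hU : IsWhiteNoiseOn U C E) (hE : MeasurableSet E)
    {a d : ℝ} (hd : 0 < d) (hI : Set.Ioo a (a + d) ⊆ E)
    (hx : ∀ x, |x| < 1 → volume {w | w ∈ E ∧ w + x ∈ E} ≠ 0) {c : ℝ} (hc0 : 0 < c) (hc : c < 1) :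
    ‖U (Set.Ico 0 c)‖ ^ 2 = C * c := by
  have hloc : ∀ x ∈ Set.Icc (-c) c, ∃ r > 0, ∀ P Q, BddMeas P → BddMeas Q →
      DiffNear x r P Q → gramDefect U C P Q = 0 := fun x hxc =>
    hU.exists_gramDefect_eq_zero_near hE hd hI (hx x ((abs_le.2 hxc).trans_lt hc))
  choose! r hr0 hr using hloc
  -- A Lebesgue number makes the radius uniform over differences in [-c, c]. Cells shorter than δ
  -- then have pairwise zero defect, and these defects add up to that of [0, c).
  obtain ⟨δ, hδ, hleb⟩ := lebesgue_number_lemma_of_metric (s := Set.Icc (-c) c)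
    (c := fun x : Set.Icc (-c) c => Metric.ball (x : ℝ) (r x)) isCompact_Icc
    (fun x => Metric.isOpen_ball)
    (fun x hx => Set.mem_iUnion.2 ⟨⟨x, hx⟩, Metric.mem_ball_self (hr0 x hx)⟩)
  obtain ⟨N, hN⟩ := exists_nat_gt (c / δ)
  have hN0 : (0 : ℝ) < N := lt_trans (by positivity) hN
  set κ := c / N with hκ
  have hκ0 : 0 < κ := by positivity
  have hκδ : κ < δ := by
    rw [hκ, div_lt_iff₀ hN0]; rw [div_lt_iff₀ hδ] at hN; linarith
  have hNκ : N * κ = c := by rw [hκ]; field_simp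
  have piece : ∀ k l : ℕ, k < N → l < N →
      gramDefect U C (Set.Ico (k * κ) ((k + 1 : ℕ) * κ)) (Set.Ico (l * κ) ((l + 1 : ℕ) * κ)) = 0 := by
    intro k l hk hl
    have hk' : (k : ℝ) * κ ≤ c := by
      rw [← hNκ]; gcongr
    have hl' : (l : ℝ) * κ ≤ c := by
      rw [← hNκ]; gcongr
    have k0 : 0 ≤ (k : ℝ) * κ := by positivity
    have l0 : 0 ≤ (l : ℝ) * κ := by positivity
    obtain ⟨x, hxb⟩ := hleb (k * κ - l * κ) ⟨by linarith, by linarith⟩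
    refine hr x x.2 _ _ (bddMeas_Ico _ _) (bddMeas_Ico _ _) ?_
    rintro y ⟨hy1, hy2⟩ z ⟨hz1, hz2⟩
    have : y - z ∈ Metric.ball (x : ℝ) (r x) := hxb (by
      push_cast at hy2 hz2
      rw [Metric.mem_ball, Real.dist_eq, abs_lt]
      constructor <;> linarith)
    rwa [Metric.mem_ball, Real.dist_eq] at this
  have split : ∀ k : ℕ, Set.Ico 0 (k * κ) ∪ Set.Ico (k * κ) ((k + 1 : ℕ) * κ) =
      Set.Ico 0 ((k + 1 : ℕ) * κ) := fun k =>
    Set.Ico_union_Ico_eq_Ico (by positivity) (by gcongr; simp)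
  have disj : ∀ k : ℕ, Disjoint (Set.Ico 0 (k * κ)) (Set.Ico (k * κ) ((k + 1 : ℕ) * κ)) := fun k =>
    Set.Ico_disjoint_Ico.2 (by simp)
  have row : ∀ k < N, ∀ m ≤ N,
      gramDefect U C (Set.Ico (k * κ) ((k + 1 : ℕ) * κ)) (Set.Ico 0 (m * κ)) = 0 := by
    intro k hk m
    induction m with
    | zero => intro _; simp [gramDefect, hU.map_empty]
    | succ m ih =>
      intro hm
      rw [← split m, hU.gramDefect_union_right (bddMeas_Ico _ _) (bddMeas_Ico _ _)
        (bddMeas_Ico _ _) (disj m), ih (by omega), piece k m hk (by omega), add_zero]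
  have col : ∀ k ≤ N, gramDefect U C (Set.Ico 0 (k * κ)) (Set.Ico 0 (N * κ)) = 0 := by
    intro k
    induction k with
    | zero => intro _; simp [gramDefect, hU.map_empty]
    | succ k ih =>
      intro hk
      rw [← split k, hU.gramDefect_union_left (bddMeas_Ico _ _) (bddMeas_Ico _ _) (disj k)
        (bddMeas_Ico _ _), ih (by omega), row k (by omega) N le_rfl, add_zero]
  have h := col N le_rfl
  rw [hNκ, gramDefect, Set.inter_self, inner_self_eq_norm_sq_to_K, sub_eq_zero] at h
  apply Complex.ofReal_injective
  rw [show C * c = C * volume.real (Set.Ico 0 c) by simp [Measure.real, hc0.le], ← h]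
  simp

end IsWhiteNoiseOn

/-! ### Characters and Fourier transforms of indicator functions -/

section expChar

variable {V : Type*} [NormedAddCommGroup V] [InnerProductSpace ℝ V]

theorem expChar_add_left (ξ η x : V) : expChar (ξ + η) x = expChar ξ x * expChar η x := by
  simp only [expChar, inner_add_left, ← Complex.exp_add]
  congr 1; push_cast; ring

theorem expChar_add_right (ξ x y : V) : expChar ξ (x + y) = expChar ξ x * expChar ξ y := by
  simp only [expChar, inner_add_right, ← Complex.exp_add]
  congr 1; push_cast; ring

theorem norm_expChar (ξ x : V) : ‖expChar ξ x‖ = 1 := by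
  rw [expChar, show 2 * (Real.pi : ℂ) * Complex.I * ((inner ℝ ξ x : ℝ) : ℂ) =
    ((2 * Real.pi * inner ℝ ξ x : ℝ) : ℂ) * Complex.I by push_cast; ring]
  exact Complex.norm_exp_ofReal_mul_I _

theorem conj_expChar (ξ x : V) : starRingEnd ℂ (expChar ξ x) = expChar (-ξ) x := by
  rw [expChar, expChar, ← Complex.exp_conj]
  simp [Complex.conj_ofReal, Complex.conj_ofNat]

theorem expChar_zero_left (x : V) : expChar 0 x = 1 := by simp [expChar]

theorem continuous_expChar (ξ : V) : Continuous (expChar ξ) := by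
  unfold expChar; fun_prop

end expChar

/-- The Fourier transform of the indicator function of `P`. -/
noncomputable def setFourier (P : Set ℝ) (ξ : ℝ) : ℂ := ∫ x in P, expChar (-ξ) x

theorem integrableOn_expChar {P : Set ℝ} (hP : BddMeas P) (ξ : ℝ) :
    IntegrableOn (expChar ξ) P := by
  refine Measure.integrableOn_of_bounded (M := 1) hP.volume_ne_top
    (continuous_expChar ξ).aestronglyMeasurable ?_
  exact Filter.Eventually.of_forall fun x => (norm_expChar ξ x).le

theorem setFourier_union {P Q : Set ℝ} (hP : BddMeas P) (hQ : BddMeas Q) (hd : Disjoint P Q)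
    (ξ : ℝ) : setFourier (P ∪ Q) ξ = setFourier P ξ + setFourier Q ξ :=
  setIntegral_union hd hQ.1 (integrableOn_expChar hP _) (integrableOn_expChar hQ _)

theorem setFourier_shift (P : Set ℝ) (s ξ : ℝ) :
    setFourier ((fun u => u + s) ⁻¹' P) ξ = expChar ξ s * setFourier P ξ := by
  have h := (measurePreserving_add_right (volume : Measure ℝ) s).setIntegral_preimage_emb
    (measurableEmbedding_addRight s) (fun x => expChar (-ξ) x) P
  simp only [expChar_add_right] at h
  rw [integral_mul_const] at h
  unfold setFourier
  rw [← h, mul_comm, mul_assoc, ← conj_expChar ξ s, mul_comm (starRingEnd ℂ _), Complex.mul_conj,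
    Complex.normSq_eq_norm_sq, norm_expChar]
  simp

/-! ### Weighted Fourier transforms as white noise -/

section weighted

variable {ι : Type*} (w : ι → ℂ) (l : ι → ℝ)

/-- Translation does not change the moduli of the entries, so a piece short enough to fit in the
interval inside E is square summable by `hgram`. A bounded set is a finite union of such pieces. -/
theorem memℓp_weighted_setFourier {E : Set ℝ} {a d C : ℝ} (hd : 0 < d)
    (hI : Set.Ioo a (a + d) ⊆ E)
    (hgram : ∀ P Q, BddMeas P → BddMeas Q → P ⊆ E → Q ⊆ E →
      HasSum (fun i => starRingEnd ℂ (w i * setFourier P (l i)) * (w i * setFourier Q (l i)))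
        ((C * volume.real (P ∩ Q) : ℝ) : ℂ)) {P : Set ℝ} (hP : BddMeas P) :
    Memℓp (fun i => w i * setFourier P (l i)) 2 := by
  have short : ∀ (P : Set ℝ) (s : ℝ), BddMeas P → (fun u => u + s) ⁻¹' P ⊆ E →
      Memℓp (fun i => w i * setFourier P (l i)) 2 := by
    intro P s hP hs
    have h := (hgram _ _ (hP.shift s) (hP.shift s) hs hs).summable.norm
    refine memℓp_gen ?_
    refine h.congr fun i => ?_
    rw [setFourier_shift]
    simp only [norm_mul, RCLike.norm_conj, norm_expChar]
    norm_num
    ring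
  -- Half the length, so that a half-open cell fits centrally in the open interval.
  set κ := d / 2
  have hκ : 0 < κ := by positivity
  have step : ∀ (t : ℝ) (k : ℕ), Memℓp
      (fun i => w i * setFourier (P ∩ Set.Ico t (t + k * κ)) (l i)) 2 := by
    intro t k
    induction k with
    | zero => simp [setFourier, zero_memℓp (E := fun _ : ι => ℂ), ← Pi.zero_def]
    | succ k ih =>
      have hu : Set.Ico t (t + (k + 1 : ℕ) * κ) =
          Set.Ico t (t + k * κ) ∪ Set.Ico (t + k * κ) (t + (k + 1 : ℕ) * κ) :=
        (Set.Ico_union_Ico_eq_Ico (by simp; positivity) (by gcongr; simp)).symm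
      have hs : (fun u => u + (t + k * κ - (a + κ / 2))) ⁻¹'
          (P ∩ Set.Ico (t + k * κ) (t + (k + 1 : ℕ) * κ)) ⊆ E := by
        rintro u ⟨-, h1, h2⟩
        push_cast at h2
        have : d = 2 * κ := by simp only [κ]; ring
        exact hI ⟨by linarith, by linarith⟩
      have h := ih.add (short _ _ (hP.inter measurableSet_Ico) hs)
      convert h using 1
      ext i
      rw [hu, Set.inter_union_distrib_left, setFourier_union (hP.inter measurableSet_Ico)
        (hP.inter measurableSet_Ico) ((Set.Ico_disjoint_Ico.2 (by simp)).mono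
          Set.inter_subset_right Set.inter_subset_right)]
      simp [mul_add]
  obtain ⟨r, hr⟩ := hP.2.subset_ball 0
  obtain ⟨N, hN⟩ := exists_nat_gt (2 * r / κ)
  rw [div_lt_iff₀ hκ] at hN
  have : P ∩ Set.Ico (-r) (-r + N * κ) = P := by
    refine Set.inter_eq_left.2 fun x hx => ?_
    have := hr hx
    rw [Metric.mem_ball, Real.dist_eq, abs_lt] at this
    exact ⟨by linarith, by linarith⟩
  exact this ▸ step (-r) N

theorem hasSum_weighted_setFourier_Ico {E : Set ℝ} (hE : MeasurableSet E) {a d C : ℝ} (hC : 0 ≤ C)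
    (hd : 0 < d) (hI : Set.Ioo a (a + d) ⊆ E)
    (hx : ∀ x, |x| < 1 → volume {w | w ∈ E ∧ w + x ∈ E} ≠ 0)
    (hgram : ∀ P Q, BddMeas P → BddMeas Q → P ⊆ E → Q ⊆ E →
      HasSum (fun i => starRingEnd ℂ (w i * setFourier P (l i)) * (w i * setFourier Q (l i)))
        ((C * volume.real (P ∩ Q) : ℝ) : ℂ)) {c : ℝ} (hc0 : 0 < c) (hc : c < 1) :
    HasSum (fun i => ‖w i‖ ^ 2 * ‖setFourier (Set.Ico 0 c) (l i)‖ ^ 2) (C * c) := by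
  classical
  -- The value 0 off the bounded Borel sets is never used.
  let U : Set ℝ → lp (fun _ : ι => ℂ) 2 := fun P =>
    if h : BddMeas P then ⟨_, memℓp_weighted_setFourier w l hd hI hgram h⟩ else 0
  have hUa : ∀ {P} (_ : BddMeas P) (i), U P i = w i * setFourier P (l i) := by
    intro P h i
    simp only [U, dif_pos h]
  have hin : ∀ {P Q} (_ : BddMeas P) (_ : BddMeas Q), HasSum
      (fun i => starRingEnd ℂ (w i * setFourier P (l i)) * (w i * setFourier Q (l i)))
      (inner ℂ (U P) (U Q)) := by
    intro P Q hP hQ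
    have := lp.hasSum_inner (𝕜 := ℂ) (U P) (U Q)
    simp only [hUa hP, hUa hQ] at this
    simpa only [RCLike.inner_apply'] using this
  have hU : IsWhiteNoiseOn U C E := by
    refine ⟨hC, ?_, ?_, ?_⟩
    · intro P Q hP hQ hd
      ext i
      simp only [lp.coeFn_add, Pi.add_apply, hUa hP, hUa hQ, hUa (hP.union hQ),
        setFourier_union hP hQ hd, mul_add]
    · intro s P Q hP hQ
      refine (hin (hP.shift s) (hQ.shift s)).unique ?_
      refine (hin hP hQ).congr_fun ?_
      intro i
      have h1 : starRingEnd ℂ (expChar (l i) s) * expChar (l i) s = 1 := by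
        rw [mul_comm, Complex.mul_conj, Complex.normSq_eq_norm_sq, norm_expChar]; simp
      simp only [setFourier_shift, map_mul]
      linear_combination (starRingEnd ℂ (w i) * starRingEnd ℂ (setFourier P (l i)) * w i *
        setFourier Q (l i)) * h1
    · intro P Q hP hQ hPE hQE
      exact (hin hP hQ).unique (hgram P Q hP hQ hPE hQE)
  have h := hU.norm_sq_Ico hE hd hI hx hc0 hc
  have h2 := lp.hasSum_norm (by norm_num) (U (Set.Ico 0 c))
  simp only [hUa (bddMeas_Ico 0 c)] at h2
  norm_num at h2
  rw [h] at h2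
  simpa only [mul_pow] using h2

end weighted

/-! ### Essential differences of the tile -/

theorem ae_shift {p : ℝ → Prop} (h : ∀ᵐ w, p w) (t : ℝ) : ∀ᵐ w, p (w + t) :=
  (measurePreserving_add_right (volume : Measure ℝ) t).quasiMeasurePreserving.ae h

theorem exists_mem_Ioo_of_ae {p : ℝ → Prop} (h : ∀ᵐ w : ℝ, p w) {a b : ℝ} (hab : a < b) :
    ∃ w ∈ Set.Ioo a b, p w := by
  by_contra! hne
  have h0 : volume (Set.Ioo a b) = 0 := measure_mono_null hne h
  rw [Real.volume_Ioo, ENNReal.ofReal_eq_zero] at h0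
  linarith

/-- If w - k ∈ E ⊆ [0, 3/2 - ε], the size of w leaves only k = 0 in the first range and k ∈ {0, -1}
in the second. -/
theorem TilesRealBy.ae_mem_of_subset_Icc {E : Set ℝ} {ε : ℝ} (hε : 0 < ε)
    (hE : E ⊆ Set.Icc 0 (3 / 2 - ε)) (h : TilesRealBy E (Set.range ((↑) : ℤ → ℝ))) :
    ∀ᵐ w : ℝ, (1 / 2 - ε < w → w < 1 → w ∈ E) ∧
      (0 ≤ w → w ≤ 1 / 2 - ε → w ∈ E ∨ w + 1 ∈ E) := by
  filter_upwards [h] with w hw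
  obtain ⟨_, ⟨⟨k, rfl⟩, hk⟩, -⟩ := hw
  have hb := hE hk
  obtain ⟨h1, h2⟩ := hb
  refine ⟨fun a b => ?_, fun a b => ?_⟩
  · have k1 : (k : ℝ) < 1 := by linarith
    have k2 : (-1 : ℝ) < k := by linarith
    have : k = 0 := by
      have := Int.cast_lt (R := ℝ).1 (by simpa using k1 : (k : ℝ) < (1 : ℤ))
      have := Int.cast_lt (R := ℝ).1 (by simpa using k2 : (((-1 : ℤ)) : ℝ) < k)
      omega
    simpa [this] using hk
  · have k1 : (k : ℝ) < 1 := by linarith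
    have k2 : (-2 : ℝ) < k := by linarith
    have : k = 0 ∨ k = -1 := by
      have := Int.cast_lt (R := ℝ).1 (by simpa using k1 : (k : ℝ) < (1 : ℤ))
      have := Int.cast_lt (R := ℝ).1 (by simpa using k2 : (((-2 : ℤ)) : ℝ) < k)
      omega
    rcases this with rfl | rfl
    · left; simpa using hk
    · right; simpa using hk

/-- A set which contains `(L, 1)`, `L < 1/2`, and meets each pair `{z, z + 1}` with `0 ≤ z ≤ L`,
has every `x ∈ (-1, 1)` as an essential difference. -/
theorem volume_inter_shift_ne_zero {E : Set ℝ} {L : ℝ} (hL : L < 1 / 2)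
    (hE : ∀ᵐ w : ℝ, (L < w → w < 1 → w ∈ E) ∧ (0 ≤ w → w ≤ L → w ∈ E ∨ w + 1 ∈ E))
    {x : ℝ} (hx : |x| < 1) : volume {w | w ∈ E ∧ w + x ∈ E} ≠ 0 := by
  wlog hx0 : 0 ≤ x generalizing x
  · have := this (x := -x) (by rwa [abs_neg]) (by linarith)
    rw [← measure_preimage_add_right volume x] at this
    convert this using 3
    ext w
    simp [and_comm]
  intro hnull
  have hx1 : x < 1 := (le_abs_self x).trans_lt hx
  have hN : ∀ᵐ w : ℝ, ¬ (w ∈ E ∧ w + x ∈ E) := by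
    rw [ae_iff]; simpa using hnull
  rcases lt_or_ge x (1 - L) with hxL | hxL
  · obtain ⟨w, ⟨h1, h2⟩, hw, hw', hn⟩ := exists_mem_Ioo_of_ae
      (hE.and ((ae_shift hE x).and hN)) (show L < 1 - x by linarith)
    exact hn ⟨hw.1 h1 (by linarith), hw'.1 (by linarith) (by linarith)⟩
  -- Here y ≤ L. For generic z ∈ (0, y), z + x ∈ E, so z ∉ E. If z + ky ≤ L is not in E, then z + ky
  -- + 1 = z + (k + 1)y + x is in E, so z + (k + 1)y is not. It is at most 2L < 1, hence at most L,
  -- as (L, 1) lies in E almost everywhere. The progression would stay below L forever.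
  set y := 1 - x with hy
  have hall : ∀ᵐ z : ℝ, ∀ k : ℕ, ((L < z + k * y → z + k * y < 1 → z + k * y ∈ E) ∧
      (0 ≤ z + k * y → z + k * y ≤ L → z + k * y ∈ E ∨ z + k * y + 1 ∈ E)) ∧
      ¬ (z + k * y ∈ E ∧ z + k * y + x ∈ E) :=
    ae_all_iff.2 fun k => ae_shift (hE.and hN) (k * y)
  obtain ⟨z, ⟨hz0, hzy⟩, hz, hzx⟩ := exists_mem_Ioo_of_ae
    (hall.and (ae_shift hE x)) (show 0 < y by linarith)
  have chain : ∀ k : ℕ, z + k * y ≤ L ∧ z + k * y ∉ E := by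
    intro k
    induction k with
    | zero =>
      have h0 := (hz 0).2
      simp only [Nat.cast_zero, zero_mul, add_zero] at h0 ⊢
      exact ⟨by linarith, fun h => h0 ⟨h, hzx.1 (by linarith) (by linarith)⟩⟩
    | succ k ih =>
      obtain ⟨hle, hnot⟩ := ih
      have hk0 : 0 ≤ z + k * y := by
        have : 0 ≤ (k : ℝ) * y := mul_nonneg k.cast_nonneg (by linarith)
        linarith
      have h1 := ((hz k).1.2 hk0 hle).resolve_left hnot
      have e : z + (k + 1 : ℕ) * y = z + k * y + y := by push_cast; ring
      have hnext : z + (k + 1 : ℕ) * y ∉ E := fun h => (hz (k + 1)).2 ⟨h, by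
        convert h1 using 1; rw [e]; linarith⟩
      refine ⟨?_, hnext⟩
      by_contra! hlt
      exact hnext ((hz (k + 1)).1.1 hlt (by rw [e]; linarith))
  obtain ⟨k, hk⟩ := exists_nat_gt (L / y)
  rw [div_lt_iff₀ (by linarith)] at hk
  linarith [(chain k).1]

/-! ### Product sets -/

section product

variable {n : ℕ} {E : Set ℝ} {F : Set (EuclideanSpace ℝ (Fin n))}

theorem measurePreserving_ofLp_restrict_euclideanProd :
    MeasurePreserving (WithLp.ofLp (p := 2) (V := ℝ × EuclideanSpace ℝ (Fin n)))
      (volume.restrict (euclideanProd E F)) ((volume.restrict E).prod (volume.restrict F)) := by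
  rw [Measure.prod_restrict]
  exact (WithLp.volume_preserving_ofLp ℝ (EuclideanSpace ℝ (Fin n))).restrict_preimage_emb
    (MeasurableEquiv.toLp 2 (ℝ × EuclideanSpace ℝ (Fin n))).symm.measurableEmbedding (E ×ˢ F)

theorem volume_euclideanProd :
    volume (euclideanProd E F) = volume E * volume F := by
  have := (measurePreserving_ofLp_restrict_euclideanProd (E := E) (F := F)).measure_preimage
    (s := Set.univ) MeasurableSet.univ.nullMeasurableSet
  rwa [Set.preimage_univ, Measure.restrict_apply_univ, ← Set.univ_prod_univ, Measure.prod_prod,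
    Measure.restrict_apply_univ, Measure.restrict_apply_univ] at this

theorem MeasureTheory.MemLp.mul_prod_two {α β : Type*} [MeasurableSpace α] [MeasurableSpace β]
    {μ : Measure α} {ν : Measure β} [SFinite μ] [SFinite ν] {f : α → ℂ} {g : β → ℂ}
    (hf : MemLp f 2 μ) (hg : MemLp g 2 ν) : MemLp (fun z => f z.1 * g z.2) 2 (μ.prod ν) := by
  refine (memLp_two_iff_integrable_sq_norm (hf.1.comp_fst.mul hg.1.comp_snd)).2 ?_
  refine (hf.integrable_norm_pow (by norm_num)).mul_prod (hg.integrable_norm_pow (by norm_num))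
    |>.congr (Filter.Eventually.of_forall fun z => ?_)
  simp [mul_pow]

theorem memLp_euclideanProd {f : ℝ → ℂ} {g : EuclideanSpace ℝ (Fin n) → ℂ}
    (hf : MemLp f 2 (volume.restrict E)) (hg : MemLp g 2 (volume.restrict F)) :
    MemLp (fun z : WithLp 2 (ℝ × EuclideanSpace ℝ (Fin n)) => f z.fst * g z.snd) 2
      (volume.restrict (euclideanProd E F)) :=
  (hf.mul_prod_two hg).comp_measurePreserving measurePreserving_ofLp_restrict_euclideanProd

theorem integral_euclideanProd_mul (f : ℝ → ℂ) (g : EuclideanSpace ℝ (Fin n) → ℂ) :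
    ∫ z in euclideanProd E F, f z.fst * g z.snd = (∫ x in E, f x) * ∫ y in F, g y := by
  rw [← integral_prod_mul]
  exact measurePreserving_ofLp_restrict_euclideanProd.integral_comp
    (MeasurableEquiv.toLp 2 (ℝ × EuclideanSpace ℝ (Fin n))).symm.measurableEmbedding
    (fun z => f z.1 * g z.2)

theorem expChar_prod (ξ z : WithLp 2 (ℝ × EuclideanSpace ℝ (Fin n))) :
    expChar ξ z = expChar ξ.fst z.fst * expChar ξ.snd z.snd := by
  have h : inner ℝ ξ z = inner ℝ ξ.fst z.fst + inner ℝ ξ.snd z.snd := WithLp.prod_inner_apply ξ z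
  simp only [expChar, h, ← Complex.exp_add]
  congr 1; push_cast; ring

end product

/-! ### Exponentials in L² -/

section spectrum

variable {V : Type*} [NormedAddCommGroup V] [InnerProductSpace ℝ V] [MeasureSpace V]
  [BorelSpace V]

theorem memLp_expChar {F : Set V} (hF : volume F ≠ ⊤) (ξ : V) :
    MemLp (expChar ξ) 2 (volume.restrict F) := by
  have : IsFiniteMeasure (volume.restrict F) := ⟨by simpa using hF.lt_top⟩
  exact MemLp.of_bound (continuous_expChar ξ).aestronglyMeasurable 1
    (Filter.Eventually.of_forall fun x => (norm_expChar ξ x).le)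

/-- The coefficient of `v` at the exponential of frequency `ξ`. -/
noncomputable def expCoeff (F : Set V) (v : Lp ℂ 2 (volume.restrict F)) (ξ : V) : ℂ :=
  ∫ y in F, expChar (-ξ) y * v y

/-- The exponential of frequency `ξ` as an element of `L²(F)`. -/
noncomputable def expLp {F : Set V} (hF : volume F ≠ ⊤) (ξ : V) : Lp ℂ 2 (volume.restrict F) :=
  (memLp_expChar hF ξ).toLp _

theorem coeFn_expLp {F : Set V} (hF : volume F ≠ ⊤) (ξ : V) :
    (expLp hF ξ : V → ℂ) =ᵐ[volume.restrict F] expChar ξ := MemLp.coeFn_toLp _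

theorem inner_expLp {F : Set V} (hF : volume F ≠ ⊤) (ξ : V) (v : Lp ℂ 2 (volume.restrict F)) :
    inner ℂ (expLp hF ξ) v = expCoeff F v ξ := by
  rw [L2.inner_def]
  refine integral_congr_ae ?_
  filter_upwards [coeFn_expLp hF ξ] with x hx
  rw [RCLike.inner_apply', hx, conj_expChar]

theorem norm_expLp {F : Set V} (hF : volume F = 1) (ξ : V) :
    ‖expLp (hF ▸ ENNReal.one_ne_top) ξ‖ = 1 := by
  have h := inner_self_eq_norm_sq_to_K (𝕜 := ℂ) (expLp (hF ▸ ENNReal.one_ne_top : volume F ≠ ⊤) ξ)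
  have h1 : expCoeff F (expLp (hF ▸ ENNReal.one_ne_top) ξ) ξ = 1 := by
    have : expCoeff F (expLp (hF ▸ ENNReal.one_ne_top) ξ) ξ = ∫ _ in F, (1 : ℂ) := by
      refine integral_congr_ae ?_
      filter_upwards [coeFn_expLp (hF ▸ ENNReal.one_ne_top : volume F ≠ ⊤) ξ] with x hx
      rw [hx, ← expChar_add_left, neg_add_cancel, expChar_zero_left]
    rw [this]
    simp [Measure.real, hF]
  rw [inner_expLp, h1] at h
  have h2 : ‖expLp (hF ▸ ENNReal.one_ne_top : volume F ≠ ⊤) ξ‖ ^ 2 = 1 := by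
    apply Complex.ofReal_injective
    simpa using h.symm
  nlinarith [norm_nonneg (expLp (hF ▸ ENNReal.one_ne_top : volume F ≠ ⊤) ξ)]

/-- An orthogonal and total system of exponentials is a spectrum. -/
theorem isSpectrum_of_orthogonal_of_total {F : Set V} (hF : volume F = 1) {Γ : Set V}
    (hΓ : Γ.Countable)
    (horth : ∀ ξ ∈ Γ, ∀ η ∈ Γ, ξ ≠ η →
      expCoeff F (expLp (hF ▸ ENNReal.one_ne_top) η) ξ = 0)
    (htot : ∀ v : Lp ℂ 2 (volume.restrict F), (∀ ξ ∈ Γ, expCoeff F v ξ = 0) → v = 0) :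
    IsSpectrum F Γ := by
  have hF' : volume F ≠ ⊤ := hF ▸ ENNReal.one_ne_top
  have hon : Orthonormal ℂ fun ξ : Γ => expLp hF' ξ.1 := by
    refine ⟨fun ξ => norm_expLp hF ξ.1, fun ξ η h => ?_⟩
    simp only [inner_expLp]
    exact horth ξ ξ.2 η η.2 fun h' => h (Subtype.ext h')
  have hsp : (Submodule.span ℂ (Set.range fun ξ : Γ => expLp hF' ξ.1))ᗮ = ⊥ := by
    rw [eq_bot_iff]
    intro v hv
    rw [Submodule.mem_bot]
    refine htot v fun ξ hξ => ?_
    rw [← inner_expLp hF']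
    exact (Submodule.mem_orthogonal _ v).1 hv _ (Submodule.subset_span ⟨⟨ξ, hξ⟩, rfl⟩)
  refine ⟨hΓ, HilbertBasis.mkOfOrthogonalEqBot hon hsp, fun ξ => ?_⟩
  rw [HilbertBasis.coe_mkOfOrthogonalEqBot]
  filter_upwards [coeFn_expLp hF' ξ.1] with x hx
  simp [hx, Measure.real, hF]

end spectrum

/-! ### Parseval's identity on the product -/

theorem hasSum_expCoeff_mul_setFourier {n : ℕ} {E : Set ℝ} (hE1 : volume E = 1)
    {F : Set (EuclideanSpace ℝ (Fin n))} (hF1 : volume F = 1)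
    {Λ : Set (WithLp 2 (ℝ × EuclideanSpace ℝ (Fin n)))}
    (hΛ : IsSpectrum (euclideanProd E F) Λ) (v : Lp ℂ 2 (volume.restrict F)) (s : ℝ) (P Q : Set ℝ)
    (hP : BddMeas P) (hQ : BddMeas Q) (hPE : (E ∩ P : Set ℝ) =ᵐ[volume] P)
    (hQE : (E ∩ Q : Set ℝ) =ᵐ[volume] Q) :
    HasSum (fun ξ : Λ => starRingEnd ℂ
        (expCoeff F v ξ.1.snd * setFourier P (ξ.1.fst - s)) *
        (expCoeff F v ξ.1.snd * setFourier Q (ξ.1.fst - s)))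
      ((‖v‖ ^ 2 * volume.real (P ∩ Q) : ℝ) : ℂ) := by
  obtain ⟨-, b, hb⟩ := hΛ
  have hv : volume.real (euclideanProd E F) = 1 := by
    simp [Measure.real, volume_euclideanProd, hE1, hF1]
  simp only [hv, Real.sqrt_one, Complex.ofReal_one, inv_one, one_mul] at hb
  let f : Set ℝ → ℝ → ℂ := fun P => P.indicator (expChar s)
  have hf : ∀ {P}, BddMeas P → MemLp (f P) 2 (volume.restrict E) := fun hP =>
    (memLp_expChar (by simp [hE1]) s).indicator hP.1
  let g : ∀ {P : Set ℝ}, BddMeas P → Lp ℂ 2 (volume.restrict (euclideanProd E F)) :=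
    fun hP => (memLp_euclideanProd (hf hP) (Lp.memLp v)).toLp _
  have hcoef : ∀ {P} (hP : BddMeas P), (E ∩ P : Set ℝ) =ᵐ[volume] P → ∀ ξ : Λ, inner ℂ (b ξ) (g hP) =
      expCoeff F v ξ.1.snd * setFourier P (ξ.1.fst - s) := by
    intro P hP hPE ξ
    rw [L2.inner_def]
    have h1 : ∫ z in euclideanProd E F, inner ℂ ((b ξ : _ → ℂ) z) ((g hP : _ → ℂ) z) =
        ∫ z in euclideanProd E F, (expChar (-ξ.1.fst) z.fst * f P z.fst) *
          (expChar (-ξ.1.snd) z.snd * v z.snd) := by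
      refine integral_congr_ae ?_
      filter_upwards [hb ξ, (memLp_euclideanProd (hf hP) (Lp.memLp v)).coeFn_toLp] with z h2 h3
      rw [RCLike.inner_apply', h2, h3, conj_expChar, expChar_prod]
      simp only [WithLp.neg_fst, WithLp.neg_snd]
      ring
    rw [h1, integral_euclideanProd_mul (fun x => expChar (-ξ.1.fst) x * f P x)
      (fun y => expChar (-ξ.1.snd) y * v y), mul_comm]
    have h4 : ∫ x in E, expChar (-ξ.1.fst) x * f P x = setFourier P (ξ.1.fst - s) := by
      have : ∀ x, expChar (-ξ.1.fst) x * f P x =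
          P.indicator (expChar (-(ξ.1.fst - s))) x := by
        intro x
        by_cases hx : x ∈ P
        · simp only [f, Set.indicator_of_mem hx]
          rw [← expChar_add_left]; congr 1; ring
        · simp [f, hx]
      simp_rw [this]
      rw [setIntegral_indicator hP.1, setIntegral_congr_set hPE]
      rfl
    rw [h4]; rfl
  have hgg : inner ℂ (g hP) (g hQ) = ((‖v‖ ^ 2 * volume.real (P ∩ Q) : ℝ) : ℂ) := by
    rw [L2.inner_def]
    have h1 : ∫ z in euclideanProd E F, inner ℂ ((g hP : _ → ℂ) z) ((g hQ : _ → ℂ) z) =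
        ∫ z in euclideanProd E F, (P ∩ Q).indicator 1 z.fst *
          (starRingEnd ℂ (v z.snd) * v z.snd) := by
      refine integral_congr_ae ?_
      filter_upwards [(memLp_euclideanProd (hf hP) (Lp.memLp v)).coeFn_toLp,
        (memLp_euclideanProd (hf hQ) (Lp.memLp v)).coeFn_toLp] with z h2 h3
      rw [RCLike.inner_apply', h2, h3]
      by_cases hx : z.fst ∈ P <;> by_cases hx' : z.fst ∈ Q <;> simp [f, hx, hx']
      have : starRingEnd ℂ (expChar s z.fst) * expChar s z.fst = 1 := by
        rw [mul_comm, Complex.mul_conj, Complex.normSq_eq_norm_sq, norm_expChar]; simp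
      linear_combination (starRingEnd ℂ (v z.snd) * v z.snd) * this
    rw [h1, integral_euclideanProd_mul ((P ∩ Q).indicator 1)
      (fun y => starRingEnd ℂ (v y) * v y), setIntegral_indicator (hP.1.inter hQ.1),
      ← Set.inter_assoc,
      setIntegral_congr_set (hPE.inter (Filter.EventuallyEq.refl _ Q))]
    have h2 : ∫ y in F, starRingEnd ℂ (v y) * v y = ((‖v‖ ^ 2 : ℝ) : ℂ) := by
      have := inner_self_eq_norm_sq_to_K (𝕜 := ℂ) v
      rw [L2.inner_def] at this
      simp only [RCLike.inner_apply'] at this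
      rw [this]; simp
    rw [h2]
    simp [mul_comm]
  have := b.hasSum_inner_mul_inner (g hP) (g hQ)
  rw [hgg] at this
  refine this.congr_fun fun ξ => ?_
  rw [← inner_conj_symm (g hP) (b ξ), hcoef hP hPE, hcoef hQ hQE]

/-! ### The Fourier transform of an interval -/

theorem setFourier_Ico_eq_intervalIntegral {c : ℝ} (hc : 0 ≤ c) (η : ℝ) :
    setFourier (Set.Ico 0 c) η = ∫ x in (0 : ℝ)..c, expChar (-η) x := by
  rw [intervalIntegral.integral_of_le hc, ← integral_Ico_eq_integral_Ioc]
  rfl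

theorem setFourier_Ico_zero {c : ℝ} (hc : 0 ≤ c) : setFourier (Set.Ico 0 c) 0 = c := by
  simp [setFourier, expChar_zero_left, hc]

theorem exists_int_of_setFourier_Ico_eq_zero {c η : ℝ} (hc : 0 < c)
    (h : setFourier (Set.Ico 0 c) η = 0) : ∃ k : ℤ, k ≠ 0 ∧ η * c = k := by
  have hη : η ≠ 0 := by
    rintro rfl
    rw [setFourier_Ico_zero hc.le] at h
    exact hc.ne' (by exact_mod_cast h)
  rw [setFourier_Ico_eq_intervalIntegral hc.le] at h
  have hz : (-(2 * (Real.pi : ℂ) * Complex.I * η)) ≠ 0 := by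
    simp [Real.pi_ne_zero, hη]
  have he : ∀ x : ℝ, expChar (-η) x = Complex.exp (-(2 * (Real.pi : ℂ) * Complex.I * η) * x) := by
    intro x
    simp only [expChar, RCLike.inner_apply', conj_trivial]
    congr 1; push_cast; ring
  simp_rw [he] at h
  rw [integral_exp_mul_complex hz, div_eq_zero_iff, or_iff_left hz, sub_eq_zero] at h
  simp only [Complex.ofReal_zero, mul_zero, Complex.exp_zero] at h
  obtain ⟨k, hk⟩ := Complex.exp_eq_one_iff.1 h
  have hk' : ((η * c : ℝ) : ℂ) = ((-k : ℤ) : ℂ) := by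
    have h2 : (2 * (Real.pi : ℂ) * Complex.I) ≠ 0 := by simp [Real.pi_ne_zero]
    apply mul_left_cancel₀ h2
    push_cast
    linear_combination -hk
  refine ⟨-k, fun h0 => ?_, by exact_mod_cast hk'⟩
  rw [h0] at hk'
  have : η * c = 0 := by exact_mod_cast hk'
  exact (mul_ne_zero hη hc.ne') this

theorem measurable_setFourier (P : Set ℝ) : Measurable (setFourier P) := by
  have : Continuous (Function.uncurry fun ξ x : ℝ => expChar (-ξ) x) := by
    unfold expChar Function.uncurry; fun_prop
  exact (this.stronglyMeasurable.integral_prod_right (ν := volume.restrict P)).measurable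

/-- Parseval for the Fourier series on [0, 1] of the modulated indicator of (0, c]. -/
theorem hasSum_sq_setFourier_add_int {c : ℝ} (hc0 : 0 ≤ c) (hc : c ≤ 1) (s : ℝ) :
    HasSum (fun k : ℤ => ‖setFourier (Set.Ico 0 c) (s + k)‖ ^ 2) c := by
  have hL2 : MemLp ((Set.Ioc 0 c).indicator (expChar (-s))) 2 (volume.restrict (Set.Ioc 0 1)) :=
    (memLp_expChar (by simp) (-s)).indicator measurableSet_Ioc
  have h := hasSum_sq_fourierCoeffOn (zero_lt_one (α := ℝ)) hL2
  have hsub : Set.Ioc (0 : ℝ) 1 ∩ Set.Ioc 0 c = Set.Ioc 0 c :=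
    Set.inter_eq_right.2 (Set.Ioc_subset_Ioc_right hc)
  have e1 : ((1 : ℝ) - 0)⁻¹ • ∫ x in (0 : ℝ)..1,
      ‖(Set.Ioc 0 c).indicator (expChar (-s)) x‖ ^ 2 = c := by
    rw [intervalIntegral.integral_of_le zero_le_one]
    have : ∀ x, ‖(Set.Ioc 0 c).indicator (expChar (-s)) x‖ ^ 2 =
        (Set.Ioc 0 c).indicator (1 : ℝ → ℝ) x := by
      intro x
      by_cases hx : x ∈ Set.Ioc 0 c <;> simp [hx, norm_expChar]
    simp_rw [this]
    rw [setIntegral_indicator measurableSet_Ioc, hsub]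
    simp [hc0]
  rw [e1] at h
  refine h.congr_fun fun k => ?_
  congr 2
  rw [fourierCoeffOn_eq_integral, intervalIntegral.integral_of_le zero_le_one]
  have : ∀ x : ℝ, fourier (-k) (x : AddCircle ((1 : ℝ) - 0)) •
      (Set.Ioc 0 c).indicator (expChar (-s)) x =
      (Set.Ioc 0 c).indicator (expChar (-(s + k))) x := by
    intro x
    by_cases hx : x ∈ Set.Ioc 0 c
    · simp only [Set.indicator_of_mem hx, fourier_coe_apply, smul_eq_mul, neg_add,
        expChar_add_left]
      rw [mul_comm]
      congr 1
      simp only [expChar, RCLike.inner_apply', conj_trivial]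
      congr 1; push_cast; ring
    · simp [hx]
  simp_rw [this]
  rw [setIntegral_indicator measurableSet_Ioc, hsub, ← integral_Ico_eq_integral_Ioc]
  simp [setFourier]

/-- Plancherel for an indicator function, obtained by folding the line onto a unit interval. -/
theorem lintegral_sq_setFourier_Ico {c : ℝ} (hc0 : 0 ≤ c) (hc : c ≤ 1) :
    ∫⁻ η, ENNReal.ofReal (‖setFourier (Set.Ico 0 c) η‖ ^ 2) = ENNReal.ofReal c := by
  set φ : ℝ → ENNReal := fun η => ENNReal.ofReal (‖setFourier (Set.Ico 0 c) η‖ ^ 2) with hφ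
  have hm : Measurable φ := ((measurable_setFourier _).norm.pow_const 2).ennreal_ofReal
  have h1 : ∫⁻ η, φ η = ∑' k : ℤ, ∫⁻ η in Set.Ioc (k : ℝ) (k + 1), φ η := by
    rw [← lintegral_iUnion (fun k => measurableSet_Ioc) (Set.pairwise_disjoint_Ioc_intCast ℝ),
      iUnion_Ioc_intCast, setLIntegral_univ]
  have h2 : ∀ k : ℤ, ∫⁻ η in Set.Ioc (k : ℝ) (k + 1), φ η =
      ∫⁻ s in Set.Ioc (0 : ℝ) 1, φ (s + k) := by
    intro k
    have := (measurePreserving_add_right (volume : Measure ℝ) (k : ℝ)).setLIntegral_comp_preimage_emb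
      (measurableEmbedding_addRight (k : ℝ)) φ (Set.Ioc (k : ℝ) (k + 1))
    rw [← this]
    simp
  rw [h1]
  simp_rw [h2]
  rw [← lintegral_tsum fun k : ℤ =>
    (show Measurable fun s : ℝ => φ (s + k) from hm.comp (measurable_add_const _)).aemeasurable]
  have h3 : ∀ s, ∑' k : ℤ, φ (s + k) = ENNReal.ofReal c := by
    intro s
    have h := hasSum_sq_setFourier_add_int hc0 hc s
    rw [← h.tsum_eq, ENNReal.ofReal_tsum_of_nonneg (fun _ => by positivity) h.summable]
  simp_rw [h3]
  simp

/-! ### Slabs of frequencies -/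

section slab

variable {n : ℕ} {F : Set (EuclideanSpace ℝ (Fin n))}
  {Λ : Set (WithLp 2 (ℝ × EuclideanSpace ℝ (Fin n)))}

/-- Parseval's identity on `Λ` for products of a modulated indicator function of `[0, c)` and a
function on `F`. -/
def IntervalParseval (F : Set (EuclideanSpace ℝ (Fin n)))
    (Λ : Set (WithLp 2 (ℝ × EuclideanSpace ℝ (Fin n)))) : Prop :=
  ∀ (v : Lp ℂ 2 (volume.restrict F)) (s c : ℝ), 0 < c → c < 1 →
    HasSum (fun ξ : Λ => ‖expCoeff F v ξ.1.snd‖ ^ 2 *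
      ‖setFourier (Set.Ico 0 c) (ξ.1.fst - s)‖ ^ 2) (‖v‖ ^ 2 * c)

/-- With v the exponential of η₂ and s = η₁, the total is c and the η-term is c², leaving at most c
- c² → 0 for the ξ-term as c → 1. The transform of [0, 1) vanishes only at nonzero integers, so the
other factor is zero. -/
theorem IntervalParseval.expCoeff_eq_zero (h : IntervalParseval F Λ) (hF : volume F = 1)
    {ξ η : Λ} (hne : ξ ≠ η) (hlt : |ξ.1.fst - η.1.fst| < 1) :
    expCoeff F (expLp (hF ▸ ENNReal.one_ne_top) η.1.snd) ξ.1.snd = 0 := by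
  have hF' : volume F ≠ ⊤ := hF ▸ ENNReal.one_ne_top
  set v := expLp hF' η.1.snd with hv
  have hv1 : ‖v‖ = 1 := norm_expLp hF _
  have hvη : ‖expCoeff F v η.1.snd‖ = 1 := by
    rw [← inner_expLp hF', inner_self_eq_norm_sq_to_K, hv1]; simp
  set δ := ξ.1.fst - η.1.fst
  have key : ∀ c : ℝ, 0 < c → c < 1 →
      ‖expCoeff F v ξ.1.snd‖ ^ 2 * ‖∫ x in (0 : ℝ)..c, expChar (-δ) x‖ ^ 2 + c ^ 2 - c ≤ 0 := by
    intro c hc0 hc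
    classical
    have h1 := sum_le_hasSum {ξ, η} (fun _ _ => by positivity) (h v η.1.fst c hc0 hc)
    rw [Finset.sum_pair hne, sub_self, setFourier_Ico_zero hc0.le, hvη, hv1,
      setFourier_Ico_eq_intervalIntegral hc0.le, Complex.norm_real,
      Real.norm_of_nonneg hc0.le] at h1
    linarith
  have hcont : Continuous fun c : ℝ =>
      ‖expCoeff F v ξ.1.snd‖ ^ 2 * ‖∫ x in (0 : ℝ)..c, expChar (-δ) x‖ ^ 2 + c ^ 2 - c := by
    have : Continuous fun c : ℝ => ∫ x in (0 : ℝ)..c, expChar (-δ) x :=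
      intervalIntegral.continuous_primitive
        (fun a b => (continuous_expChar (-δ)).intervalIntegrable a b) 0
    fun_prop
  have hlim := le_of_tendsto (hcont.continuousAt.tendsto.mono_left
    (nhdsWithin_le_nhds (a := (1 : ℝ)) (s := Set.Iio 1)))
    (Filter.mem_of_superset (Ioo_mem_nhdsLT zero_lt_one) fun c hc => key c hc.1 hc.2)
  rw [← setFourier_Ico_eq_intervalIntegral zero_le_one] at hlim
  have hS : setFourier (Set.Ico 0 1) δ ≠ 0 := by
    intro h0
    obtain ⟨k, hk0, hk⟩ := exists_int_of_setFourier_Ico_eq_zero one_pos h0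
    rw [mul_one] at hk
    rw [hk] at hlt
    have : |k| < 1 := by exact_mod_cast hlt
    exact hk0 (Int.abs_lt_one_iff.1 this)
  have h3 : ‖expCoeff F v ξ.1.snd‖ ^ 2 * ‖setFourier (Set.Ico 0 1) δ‖ ^ 2 = 0 :=
    le_antisymm (by linarith) (by positivity)
  rcases mul_eq_zero.1 h3 with h4 | h4
  · simpa using h4
  · exact absurd (by simpa using h4) hS

/-- The frequencies whose first coordinate lies in `[a, a + 1)`. -/
def slab (Λ : Set (WithLp 2 (ℝ × EuclideanSpace ℝ (Fin n)))) (a : ℝ) : Set Λ :=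
  {ξ | ξ.1.fst - a ∈ Set.Ico (0 : ℝ) 1}

theorem IntervalParseval.orthonormal_slab (h : IntervalParseval F Λ) (hF : volume F = 1) (a : ℝ) :
    Orthonormal ℂ fun ξ : slab Λ a =>
      expLp (hF ▸ ENNReal.one_ne_top : volume F ≠ ⊤) ξ.1.1.snd := by
  refine ⟨fun ξ => norm_expLp hF _, fun ξ η hne => ?_⟩
  simp only [inner_expLp]
  refine h.expCoeff_eq_zero hF (fun h' => hne (Subtype.ext h')) ?_
  obtain ⟨h1, h2⟩ := ξ.2
  obtain ⟨h3, h4⟩ := η.2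
  rw [abs_lt]
  constructor <;> linarith

theorem IntervalParseval.tsum_slab (h : IntervalParseval F Λ) (hF : volume F = 1) (a : ℝ)
    (v : Lp ℂ 2 (volume.restrict F)) :
    ∑' ξ : Λ, (slab Λ a).indicator (fun ξ => ENNReal.ofReal (‖expCoeff F v ξ.1.snd‖ ^ 2)) ξ =
      ENNReal.ofReal (∑' ξ : slab Λ a, ‖expCoeff F v ξ.1.1.snd‖ ^ 2) := by
  have hs := (h.orthonormal_slab hF a).inner_products_summable v
  simp only [inner_expLp] at hs
  rw [← tsum_subtype, ENNReal.ofReal_tsum_of_nonneg (fun _ => by positivity) hs]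

/-- Substituting u = ξ₁ - a term by term turns the slab condition into u ∈ [0, 1). For each fixed u
the sum is then the interval identity with s = u. -/
theorem IntervalParseval.lintegral_tsum_slab (h : IntervalParseval F Λ) (hΛ : Λ.Countable)
    {c : ℝ} (hc0 : 0 < c) (hc : c < 1) (v : Lp ℂ 2 (volume.restrict F)) :
    ∫⁻ a, ENNReal.ofReal (‖setFourier (Set.Ico 0 c) a‖ ^ 2) * ∑' ξ : Λ,
      (slab Λ a).indicator (fun ξ => ENNReal.ofReal (‖expCoeff F v ξ.1.snd‖ ^ 2)) ξ =
      ENNReal.ofReal (‖v‖ ^ 2 * c) := by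
  have := hΛ.to_subtype
  set φ : ℝ → ENNReal := fun η => ENNReal.ofReal (‖setFourier (Set.Ico 0 c) η‖ ^ 2)
  have hφ : Measurable φ := ((measurable_setFourier _).norm.pow_const 2).ennreal_ofReal
  set g : Λ → ENNReal := fun ξ => ENNReal.ofReal (‖expCoeff F v ξ.1.snd‖ ^ 2)
  let f : Λ → ℝ → ENNReal := fun ξ u =>
    (Set.Ico (0 : ℝ) 1).indicator (fun u => g ξ * φ (ξ.1.fst - u)) u
  have hf : ∀ ξ, Measurable (f ξ) := fun ξ =>
    ((hφ.comp (measurable_const_sub _)).const_mul _).indicator measurableSet_Ico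
  have e1 : ∀ a, φ a * ∑' ξ : Λ, (slab Λ a).indicator g ξ = ∑' ξ : Λ, f ξ (ξ.1.fst - a) := by
    intro a
    rw [← ENNReal.tsum_mul_left]
    refine tsum_congr fun ξ => ?_
    by_cases hξ : ξ.1.fst - a ∈ Set.Ico (0 : ℝ) 1
    · have hξ' : ξ ∈ slab Λ a := hξ
      simp only [f, Set.indicator_of_mem hξ, Set.indicator_of_mem hξ', sub_sub_cancel, mul_comm]
    · have hξ' : ξ ∉ slab Λ a := hξ
      simp only [f, Set.indicator_of_notMem hξ, Set.indicator_of_notMem hξ', mul_zero]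
  refine (lintegral_congr e1).trans ?_
  rw [lintegral_tsum fun ξ =>
    (show Measurable fun a => f ξ (ξ.1.fst - a) from
      (hf ξ).comp (measurable_const_sub _)).aemeasurable]
  rw [tsum_congr fun ξ : Λ => lintegral_sub_left_eq_self (f ξ) ξ.1.fst]
  simp only [f, lintegral_indicator measurableSet_Ico]
  rw [← lintegral_tsum fun ξ =>
    (show Measurable fun u => g ξ * φ (ξ.1.fst - u) from
      (hφ.comp (measurable_const_sub _)).const_mul _).aemeasurable]
  have e2 : ∀ u : ℝ, ∑' ξ : Λ, g ξ * φ (ξ.1.fst - u) = ENNReal.ofReal (‖v‖ ^ 2 * c) := by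
    intro u
    have hs := h v u c hc0 hc
    rw [← hs.tsum_eq, ENNReal.ofReal_tsum_of_nonneg (fun _ => by positivity) hs.summable]
    exact tsum_congr fun ξ => (ENNReal.ofReal_mul (by positivity)).symm
  simp_rw [e2]
  simp

/-- Both sides of Bessel's inequality have the same finite weighted integral, and the weight
vanishes only on a countable set. Any c ∈ (0, 1) would serve in place of 1/2. -/
theorem IntervalParseval.ae_tsum_slab_eq (h : IntervalParseval F Λ) (hΛ : Λ.Countable)
    (hF : volume F = 1) (v : Lp ℂ 2 (volume.restrict F)) :
    ∀ᵐ a : ℝ, ∑' ξ : slab Λ a, ‖expCoeff F v ξ.1.1.snd‖ ^ 2 = ‖v‖ ^ 2 := by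
  have hc0 : (0 : ℝ) < 1 / 2 := by norm_num
  set φ : ℝ → ENNReal := fun η => ENNReal.ofReal (‖setFourier (Set.Ico 0 (1 / 2)) η‖ ^ 2) with hφd
  have hφ : Measurable φ := ((measurable_setFourier _).norm.pow_const 2).ennreal_ofReal
  have hbes : ∀ a, ∑' ξ : slab Λ a, ‖expCoeff F v ξ.1.1.snd‖ ^ 2 ≤ ‖v‖ ^ 2 := by
    intro a
    have := (h.orthonormal_slab hF a).tsum_inner_products_le (x := v)
    simpa only [inner_expLp] using this
  have hint := h.lintegral_tsum_slab hΛ hc0 (by norm_num) v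
  simp_rw [h.tsum_slab hF] at hint
  have hφ0 : ∀ᵐ a : ℝ, φ a ≠ 0 := by
    have hcount : (Set.range fun k : ℤ => (k : ℝ) / (1 / 2)).Countable := Set.countable_range _
    filter_upwards [compl_mem_ae_iff.2 (hcount.measure_zero volume)] with a ha h0
    have h1 : setFourier (Set.Ico 0 (1 / 2)) a = 0 := by
      by_contra hne
      exact (ENNReal.ofReal_pos.2 (by positivity : 0 <
        ‖setFourier (Set.Ico 0 (1 / 2)) a‖ ^ 2)).ne' h0
    obtain ⟨k, -, hk⟩ := exists_int_of_setFourier_Ico_eq_zero hc0 h1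
    exact ha ⟨k, show (k : ℝ) / (1 / 2) = a by rw [← hk]; ring⟩
  have htot : ∫⁻ a, φ a * ENNReal.ofReal (‖v‖ ^ 2) = ENNReal.ofReal (‖v‖ ^ 2 * (1 / 2)) := by
    rw [lintegral_mul_const _ hφ, lintegral_sq_setFourier_Ico hc0.le (by norm_num), mul_comm,
      ← ENNReal.ofReal_mul (by positivity)]
  have hae := ae_eq_of_ae_le_of_lintegral_le (μ := volume)
    (f := fun a => φ a * ENNReal.ofReal (∑' ξ : slab Λ a, ‖expCoeff F v ξ.1.1.snd‖ ^ 2))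
    (g := fun a => φ a * ENNReal.ofReal (‖v‖ ^ 2))
    (Filter.Eventually.of_forall fun a => by
      simp only
      gcongr
      exact hbes a)
    (by rw [hint]; exact ENNReal.ofReal_ne_top) (hφ.mul_const _).aemeasurable
    (by rw [hint, htot])
  filter_upwards [hae, hφ0] with a ha ha0
  have h1 := (ENNReal.mul_right_inj ha0 ENNReal.ofReal_ne_top).1 ha
  exact (ENNReal.ofReal_eq_ofReal_iff (tsum_nonneg fun _ => by positivity) (by positivity)).1 h1

theorem IntervalParseval.isSpectral (h : IntervalParseval F Λ) (hΛ : Λ.Countable)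
    (hF : volume F = 1) : IsSpectral F := by
  have hF' : volume F ≠ ⊤ := hF ▸ ENNReal.one_ne_top
  have : Fact ((2 : ENNReal) ≠ ⊤) := ⟨by norm_num⟩
  -- The exceptional null set of a depends on v; a countable dense D yields one a for all v ∈ D.
  obtain ⟨D, hDc, hD⟩ := TopologicalSpace.exists_countable_dense (Lp ℂ 2 (volume.restrict F))
  have hall : ∀ᵐ a : ℝ, ∀ v ∈ D, ∑' ξ : slab Λ a, ‖expCoeff F v ξ.1.1.snd‖ ^ 2 = ‖v‖ ^ 2 :=
    (ae_ball_iff hDc).2 fun v _ => h.ae_tsum_slab_eq hΛ hF v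
  obtain ⟨a, ha⟩ := hall.exists
  have := hΛ.to_subtype
  refine ⟨(fun ξ : Λ => ξ.1.snd) '' slab Λ a, isSpectrum_of_orthogonal_of_total hF
    ((Set.to_countable _).image _) ?_ ?_⟩
  · rintro _ ⟨ξ, hξ, rfl⟩ _ ⟨η, hη, rfl⟩ hne
    have hne' : (⟨ξ, hξ⟩ : slab Λ a) ≠ ⟨η, hη⟩ := fun h' => hne (by
      rw [show ξ = η from congrArg Subtype.val h'])
    have := (h.orthonormal_slab hF a).2 hne'
    rw [← inner_expLp hF']
    exact this
  · intro v hv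
    -- If v is orthogonal to the slab, u and u - v have equal coefficients: Parseval for u and
    -- Bessel for u - v compare the norms. By density u = v is allowed, so v = 0.
    have hle : ∀ u ∈ D, ‖u‖ ≤ ‖u - v‖ := by
      intro u hu
      have hb := (h.orthonormal_slab hF a).tsum_inner_products_le (x := u - v)
      simp only [inner_sub_right, inner_expLp] at hb
      have : ∀ ξ : slab Λ a, expCoeff F v ξ.1.1.snd = 0 := fun ξ => hv _ ⟨ξ.1, ξ.2, rfl⟩
      simp only [this, sub_zero, ha u hu] at hb
      exact (sq_le_sq₀ (norm_nonneg _) (norm_nonneg _)).1 hb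
    have hcl : ∀ u, ‖u‖ ≤ ‖u - v‖ := fun u =>
      hD.induction hle (isClosed_le continuous_norm (continuous_id.sub continuous_const).norm) u
    simpa using hcl v

end slab

/-! ### The proposition -/

theorem proposition3p3 (n : ℕ) (E : Set ℝ) (F : Set (EuclideanSpace ℝ (Fin n))) (ε : ℝ)
    (hε : 0 < ε)
    (hE_meas : NullMeasurableSet E volume)
    (hE_sub : E ⊆ Set.Icc 0 (3 / 2 - ε))
    (hE_vol : volume E = 1)
    (hE_tile : TilesRealBy E (Set.range ((↑) : ℤ → ℝ)))
    (hF_bdd : Bornology.IsBounded F)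
    (hF_meas : NullMeasurableSet F volume)
    (hF_vol : volume F = 1)
    (hEF : IsSpectral (euclideanProd E F)) :
    IsSpectral F := by
  obtain ⟨Λ, hΛ⟩ := hEF
  have hL : 1 / 2 - ε < 1 / 2 := by linarith
  have hae := hE_tile.ae_mem_of_subset_Icc hε hE_sub
  -- The tiling puts I in E only up to a null set. G is a Borel set, almost everywhere equal to E,
  -- that contains I outright.
  obtain ⟨E₀, -, hE₀, hE₀E⟩ := hE_meas.exists_measurable_superset_ae_eq
  set I := Set.Ioo (1 / 2 - ε) (1 / 2 - ε + 1 / 2)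
  set G := E₀ ∪ I
  have hG : MeasurableSet G := hE₀.union measurableSet_Ioo
  have hmem : ∀ᵐ x : ℝ, x ∈ G ↔ x ∈ E := by
    filter_upwards [hae, hE₀E.mem_iff] with x hx hx'
    refine ⟨?_, fun h => Or.inl (hx'.2 h)⟩
    rintro (h | h)
    · exact hx'.1 h
    · exact hx.1 h.1 (by linarith [h.2])
  have hdiff : ∀ x, |x| < 1 → volume {w | w ∈ G ∧ w + x ∈ G} ≠ 0 := fun x hx =>
    volume_inter_shift_ne_zero hL (by
      filter_upwards [hae, hmem, ae_shift hmem 1] with w h1 h2 h3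
      rwa [h2, h3]) hx
  have hGP : ∀ P : Set ℝ, P ⊆ G → (E ∩ P : Set ℝ) =ᵐ[volume] P := by
    intro P hP
    refine Filter.eventuallyEq_set.2 ?_
    filter_upwards [hmem] with x hx
    exact ⟨fun h => h.2, fun h => ⟨hx.1 (hP h), h⟩⟩
  have hpars : IntervalParseval F Λ := fun v s c hc0 hc =>
    hasSum_weighted_setFourier_Ico (fun ξ : Λ => expCoeff F v ξ.1.snd) (fun ξ : Λ => ξ.1.fst - s)
      hG (sq_nonneg ‖v‖) (by norm_num) Set.subset_union_right hdiff
      (fun P Q hP hQ hPG hQG => hasSum_expCoeff_mul_setFourier hE_vol hF_vol hΛ v s P Q hP hQ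
        (hGP P hPG) (hGP Q hQG)) hc0 hc
  exact hpars.isSpectral hΛ.1 hF_vol
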